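/- For a field $k$, define an absolute value on $k((X^{-1}))$ by $|0|=0$ and $|F|=2^m$ if $F=\sum_{h\ge -m} f_hX^{-h}$ with $f_{-m}\neq 0$, and let $\|F\|$ denote $|\{F\}|$, where $\{F\}=\sum_{h\ge 1}f_hX^{-h}$ is the fractional part of $F$. The polynomial $Z^4+Z^2-XZ+1$ has a unique root $\Theta$ in $\mathbf F_3((X^{-1}))$. For this $\Theta$ we have $$\inf_{q\in\mathbf F_3[X]\setminus\{0\}}|q|^2\cdot\|q\Theta\|\cdot\|q\Theta^{-1}\|<+\infty,$$ and moreover $$\liminf_{q\in\mathbf F_3[X],\ \deg q\to+\infty}|q|^2\cdot\|q\Theta\|\cdot\|q\Theta^{-1}\|<+\infty.$$ Furthermore, for every real $\varepsilon>0$ there is an integer $D$ such that $$|q|^{2+4/\sqrt{3\deg q}+\varepsilon}\cdot\|q\Theta\|\cdot\|q\Theta^{-1}\|\ge 1$$ for every $q\in\mathbf F_3[X]$ with $\deg q\ge D$, where the exponent is $2+\frac{4}{\sqrt{3\deg q}}+\varepsilon$. -/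

import Mathlib

open Filter

noncomputable section

namespace PowerSeriesField

/-- The field `k((X⁻¹))` of formal Laurent series in `X⁻¹`. An element
`F = ∑ₕ f_h X^(-h)` is stored as the Laurent series in the uniformizer `X⁻¹`, so that `f_h` is
`F.coeff h`, and only finitely many `f_h` with `h ≤ 0` are nonzero. -/
abbrev SeriesAtInfinity (k : Type*) [Field k] : Type _ := LaurentSeries k

variable {k : Type*} [Field k]

/-- The indeterminate `X`, as an element of `k((X⁻¹))`. -/
def seriesX (k : Type*) [Field k] : SeriesAtInfinity k := HahnSeries.single (-1 : ℤ) (1 : k)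

/-- The inclusion of `k[X]` in `k((X⁻¹))`, which sends constants to constants and `X` to `X`. -/
def ofPoly : Polynomial k →+* SeriesAtInfinity k :=
  Polynomial.eval₂RingHom HahnSeries.C (seriesX k)

open Classical in
/-- The absolute value on `k((X⁻¹))`: `|0| = 0`, and `|F| = 2 ^ m` if
`F = ∑_{h ≥ -m} f_h X^(-h)` with `f_{-m} ≠ 0` (that is, if `F` has order `-m` in `X⁻¹`). -/
def absInf (F : SeriesAtInfinity k) : ℝ := if F = 0 then 0 else (2 : ℝ) ^ (-F.order)

/-- The fractional part of `F`: the part of the series which comprises only the negative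
powers of `X`. -/
def fracPart (F : SeriesAtInfinity k) : SeriesAtInfinity k where
  coeff h := if 0 < h then F.coeff h else 0
  isPWO_support' := F.isPWO_support.mono (by
    intro h hh
    by_cases h0 : 0 < h <;> simp_all [Function.mem_support])

/-- `‖F‖`: the absolute value of the fractional part of `F`. -/
def distPoly (F : SeriesAtInfinity k) : ℝ := absInf (fracPart F)

end PowerSeriesField

end

/-! The root is a continued fraction Θ = [0; a₁, a₂, …] whose partial quotients are the limit of the
words W_{n+2} = W_{n+1}, -X, W_n^(3), -X, W_{n+1}, where W^(3) cubes each entry. The continuant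
matrices are symmetric with entries q, r, s, and in characteristic 3 they satisfy qs - r² = ε and s²
+ r² - Xqr + q² = -ε with ε² = 1 (`exists_contMatrix_quarticWord`). Eliminating s shows that r/q
almost annihilates the quartic, hence is very close to Θ (`IsQuarticRoot.absInf_mul_sub_le`).

Upper bound: by symmetry r is both the numerator of r/q and the denominator of the preceding
convergent s/r, so rΘ and rΘ⁻¹ are both within 1/|q| of polynomials, and |r| < |q|.

Lower bound: partial quotients in W_n have degree at most 3^(n/2), while the denominator has degree
(3^n - 1)/2. So |Q|‖QΘ‖ and |Q|‖QΘ⁻¹‖ are at least 2^(-O(√deg Q)), a loss which |Q|^ε absorbs for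
large degree. Of the term 4/√(3 deg q) only nonnegativity matters. -/

noncomputable section

namespace PowerSeriesField

/-! ### The ultrametric absolute value and the distance to polynomials. -/

section AbsoluteValue

variable {k : Type*} [Field k]

lemma absInf_zero : absInf (0 : SeriesAtInfinity k) = 0 := by simp [absInf]

lemma absInf_of_ne_zero {F : SeriesAtInfinity k} (hF : F ≠ 0) :
    absInf F = (2 : ℝ) ^ (-F.order) := by simp [absInf, hF]

/-- The absolute value on `k((X⁻¹))` as a homomorphism of monoids with zero. -/
def absInfHom : SeriesAtInfinity k →*₀ ℝ where
  toFun := absInf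
  map_zero' := absInf_zero
  map_one' := by simp [absInf]
  map_mul' F G := by
    by_cases hF : F = 0
    · simp [hF, absInf_zero]
    by_cases hG : G = 0
    · simp [hG, absInf_zero]
    rw [absInf_of_ne_zero hF, absInf_of_ne_zero hG, absInf_of_ne_zero (mul_ne_zero hF hG),
      HahnSeries.order_mul hF hG, neg_add, zpow_add₀ two_ne_zero]

lemma absInf_mul (F G : SeriesAtInfinity k) : absInf (F * G) = absInf F * absInf G :=
  map_mul absInfHom F G

lemma absInf_one : absInf (1 : SeriesAtInfinity k) = 1 := map_one absInfHom

lemma absInf_pow (F : SeriesAtInfinity k) (n : ℕ) : absInf (F ^ n) = absInf F ^ n :=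
  map_pow absInfHom F n

lemma absInf_inv (F : SeriesAtInfinity k) : absInf F⁻¹ = (absInf F)⁻¹ :=
  map_inv₀ absInfHom F

lemma absInf_neg (F : SeriesAtInfinity k) : absInf (-F) = absInf F := by
  by_cases hF : F = 0
  · rw [hF, neg_zero]
  · rw [absInf_of_ne_zero hF, absInf_of_ne_zero (neg_ne_zero.2 hF), HahnSeries.order_neg]

lemma absInf_pos {F : SeriesAtInfinity k} (hF : F ≠ 0) : 0 < absInf F := by
  rw [absInf_of_ne_zero hF]; positivity

lemma absInf_nonneg (F : SeriesAtInfinity k) : 0 ≤ absInf F := by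
  by_cases hF : F = 0
  · rw [hF, absInf_zero]
  · exact (absInf_pos hF).le

lemma absInf_add_le_max (F G : SeriesAtInfinity k) :
    absInf (F + G) ≤ max (absInf F) (absInf G) := by
  by_cases hF : F = 0
  · simp [hF]
  by_cases hG : G = 0
  · simp [hG]
  by_cases h : F + G = 0
  · rw [h, absInf_zero]; exact le_max_of_le_left (absInf_nonneg F)
  rw [absInf_of_ne_zero hF, absInf_of_ne_zero hG, absInf_of_ne_zero h, le_max_iff,
    zpow_le_zpow_iff_right₀ one_lt_two, zpow_le_zpow_iff_right₀ one_lt_two]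
  have := HahnSeries.min_order_le_order_add h
  rw [min_le_iff] at this
  omega

lemma absInf_add_le {F G : SeriesAtInfinity k} {c : ℝ} (hF : absInf F ≤ c) (hG : absInf G ≤ c) :
    absInf (F + G) ≤ c :=
  (absInf_add_le_max F G).trans (max_le hF hG)

lemma absInf_sub_le {F G : SeriesAtInfinity k} {c : ℝ} (hF : absInf F ≤ c) (hG : absInf G ≤ c) :
    absInf (F - G) ≤ c := by
  rw [sub_eq_add_neg]
  exact absInf_add_le hF ((absInf_neg G).le.trans hG)

lemma absInf_add_eq_left {F G : SeriesAtInfinity k} (h : absInf G < absInf F) :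
    absInf (F + G) = absInf F := by
  refine le_antisymm (absInf_add_le le_rfl h.le) ?_
  by_contra! hlt
  have := absInf_add_le_max (F + G) (-G)
  rw [add_neg_cancel_right, absInf_neg, le_max_iff] at this
  rcases this with h1 | h1 <;> linarith

lemma absInf_sub_eq_left {F G : SeriesAtInfinity k} (h : absInf G < absInf F) :
    absInf (F - G) = absInf F := by
  rw [sub_eq_add_neg]
  exact absInf_add_eq_left (by rwa [absInf_neg])

lemma absInf_seriesX : absInf (seriesX k) = 2 := by
  rw [absInf_of_ne_zero (by simp [seriesX]), seriesX, HahnSeries.order_single one_ne_zero]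
  norm_num

lemma ofPoly_X : ofPoly (Polynomial.X : Polynomial k) = seriesX k := by
  simp [ofPoly]

lemma ofPoly_monomial (n : ℕ) (a : k) :
    ofPoly (Polynomial.monomial n a) = HahnSeries.single (-(n : ℤ)) a := by
  simp [ofPoly, seriesX, Polynomial.eval₂_monomial, HahnSeries.C_apply,
    HahnSeries.single_pow, HahnSeries.single_mul_single]

lemma coeff_ofPoly (q : Polynomial k) (h : ℤ) :
    (ofPoly q).coeff h = if h ≤ 0 then q.coeff (-h).toNat else 0 := by
  induction q using Polynomial.induction_on' with
  | add p q hp hq => rw [map_add, HahnSeries.coeff_add, hp, hq]; split_ifs <;> simp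
  | monomial n a =>
    rw [ofPoly_monomial, Polynomial.coeff_monomial, HahnSeries.coeff_single]
    split_ifs <;> first | rfl | omega

lemma absInf_ofPoly {q : Polynomial k} (hq : q ≠ 0) :
    absInf (ofPoly q) = (2 : ℝ) ^ q.natDegree := by
  have hc : (ofPoly q).coeff (-(q.natDegree : ℤ)) ≠ 0 := by
    simpa [coeff_ofPoly] using hq
  have h0 : ofPoly q ≠ 0 := by
    intro h; simp [h] at hc
  have : (ofPoly q).order = -(q.natDegree : ℤ) := by
    refine le_antisymm (HahnSeries.order_le_of_coeff_ne_zero hc) ?_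
    rw [HahnSeries.le_order_iff_forall h0]
    intro j hj
    rw [coeff_ofPoly]
    split_ifs
    · exact Polynomial.coeff_eq_zero_of_natDegree_lt (by omega)
    · rfl
  rw [absInf_of_ne_zero h0, this, neg_neg, zpow_natCast]

lemma ofPoly_ne_zero {q : Polynomial k} (hq : q ≠ 0) : ofPoly q ≠ 0 := by
  intro h
  have := absInf_ofPoly hq
  rw [h, absInf_zero] at this
  exact (pow_pos two_pos _).ne this

lemma absInf_ofPoly_le (q : Polynomial k) : absInf (ofPoly q) ≤ (2 : ℝ) ^ q.natDegree := by
  by_cases hq : q = 0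
  · simp [hq, absInf_zero]
  · exact (absInf_ofPoly hq).le

lemma coeff_eq_zero_of_absInf_lt_one {F : SeriesAtInfinity k} (hF : absInf F < 1) {h : ℤ}
    (hh : h ≤ 0) : F.coeff h = 0 := by
  by_cases h0 : F = 0
  · simp [h0]
  rw [absInf_of_ne_zero h0, zpow_lt_one_iff_right₀ one_lt_two] at hF
  exact HahnSeries.coeff_eq_zero_of_lt_order (by omega)

lemma absInf_fracPart_lt_one (F : SeriesAtInfinity k) : absInf (fracPart F) < 1 := by
  by_cases h0 : fracPart F = 0
  · rw [h0, absInf_zero]; exact one_pos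
  rw [absInf_of_ne_zero h0, zpow_lt_one_iff_right₀ one_lt_two]
  have h1 : (fracPart F).coeff (fracPart F).order ≠ 0 := HahnSeries.coeff_order_eq_zero.not.2 h0
  by_contra! h2
  generalize (fracPart F).order = i at h1 h2
  exact h1 (if_neg (by omega))

lemma fracPart_eq_sub {F : SeriesAtInfinity k} {P : Polynomial k}
    (h : absInf (F - ofPoly P) < 1) : fracPart F = F - ofPoly P := by
  ext i
  by_cases hi : 0 < i
  · rw [HahnSeries.coeff_sub, coeff_ofPoly, if_neg (by omega), sub_zero]
    exact if_pos hi
  · rw [coeff_eq_zero_of_absInf_lt_one h (by omega)]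
    exact if_neg hi

lemma distPoly_eq {F : SeriesAtInfinity k} {P : Polynomial k}
    (h : absInf (F - ofPoly P) < 1) : distPoly F = absInf (F - ofPoly P) := by
  rw [distPoly, fracPart_eq_sub h]

lemma exists_fracPart_eq (F : SeriesAtInfinity k) :
    ∃ P : Polynomial k, fracPart F = F - ofPoly P := by
  refine ⟨∑ i ∈ Finset.range (F.order.natAbs + 1), Polynomial.monomial i (F.coeff (-(i : ℤ))), ?_⟩
  ext i
  have hf : (fracPart F).coeff i = if 0 < i then F.coeff i else 0 := rfl
  rw [hf, HahnSeries.coeff_sub, coeff_ofPoly]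
  split_ifs with h1 h2 h2
  · omega
  · simp
  · rw [Polynomial.finsetSum_coeff]
    simp only [Polynomial.coeff_monomial]
    rw [Finset.sum_ite_eq']
    split_ifs with h3
    · have : -(((-i).toNat : ℕ) : ℤ) = i := by omega
      rw [this, sub_self]
    · rw [Finset.mem_range] at h3
      rw [HahnSeries.coeff_eq_zero_of_lt_order (by omega), sub_self]
  · omega

lemma exists_distPoly_eq (F : SeriesAtInfinity k) :
    ∃ P : Polynomial k, distPoly F = absInf (F - ofPoly P) ∧ absInf (F - ofPoly P) < 1 := by
  obtain ⟨P, hP⟩ := exists_fracPart_eq F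
  exact ⟨P, by rw [distPoly, hP], hP ▸ absInf_fracPart_lt_one F⟩

end AbsoluteValue

/-! ### Continuants and the quality of rational approximations. -/

section ContinuedFraction

open Polynomial

variable {k : Type*} [Field k]

/-- The continuant matrix of a list `[a₁, …, aₙ]`: its first column holds the denominator and the
numerator of the continued fraction `1 / (a₁ + 1 / (a₂ + ⋯))`. -/
def contMatrix (L : List k[X]) : Matrix (Fin 2) (Fin 2) k[X] :=
  (L.map fun a => !![a, 1; 1, 0]).prod

lemma contMatrix_nil : contMatrix ([] : List k[X]) = 1 := rfl

lemma contMatrix_cons (a : k[X]) (L : List k[X]) :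
    contMatrix (a :: L) = !![a, 1; 1, 0] * contMatrix L := by
  simp [contMatrix]

lemma contMatrix_append (L₁ L₂ : List k[X]) :
    contMatrix (L₁ ++ L₂) = contMatrix L₁ * contMatrix L₂ := by
  simp [contMatrix]

lemma contMatrix_map (φ : k[X] →+* k[X]) (L : List k[X]) :
    contMatrix (L.map φ) = (contMatrix L).map φ := by
  induction L with
  | nil => simp [contMatrix_nil]
  | cons a L ih =>
    rw [List.map_cons, contMatrix_cons, contMatrix_cons, ih, Matrix.map_mul]
    congr 1
    ext i j
    fin_cases i <;> fin_cases j <;> simp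

lemma contMatrix_cons_zero (a : k[X]) (L : List k[X]) :
    contMatrix (a :: L) 0 0 = a * contMatrix L 0 0 + contMatrix L 1 0 := by
  simp [contMatrix_cons, Matrix.mul_apply, Fin.sum_univ_two]

lemma contMatrix_cons_one (a : k[X]) (L : List k[X]) :
    contMatrix (a :: L) 1 0 = contMatrix L 0 0 := by
  simp [contMatrix_cons, Matrix.mul_apply, Fin.sum_univ_two]

lemma contMatrix_degree (L : List k[X]) (hL : ∀ a ∈ L, 1 ≤ a.natDegree) :
    contMatrix L 0 0 ≠ 0 ∧ (contMatrix L 0 0).natDegree = (L.map natDegree).sum ∧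
      (contMatrix L 1 0).degree < (contMatrix L 0 0).degree := by
  induction L with
  | nil => simp [contMatrix_nil]
  | cons a L ih =>
    obtain ⟨h0, h1, h2⟩ := ih fun b hb => hL b (List.mem_cons_of_mem _ hb)
    have ha : 1 ≤ a.natDegree := hL a List.mem_cons_self
    have ha0 : a ≠ 0 := by rintro rfl; simp at ha
    have hdeg : (contMatrix L 0 0).degree < (a * contMatrix L 0 0).degree := by
      rw [degree_eq_natDegree h0, degree_eq_natDegree (mul_ne_zero ha0 h0), natDegree_mul ha0 h0]
      exact_mod_cast (by omega)
    have hsum : (contMatrix (a :: L) 0 0).degree = (a * contMatrix L 0 0).degree := by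
      rw [contMatrix_cons_zero]
      exact degree_add_eq_left_of_degree_lt (h2.trans hdeg)
    refine ⟨?_, ?_, ?_⟩
    · intro h
      rw [h, degree_zero] at hsum
      exact mul_ne_zero ha0 h0 (degree_eq_bot.1 hsum.symm)
    · rw [natDegree_eq_of_degree_eq hsum, natDegree_mul ha0 h0, h1]
      simp
    · rw [hsum, contMatrix_cons_one]
      exact hdeg

/-- If the partial quotients of `t / q` have degree at most `G`, then no fraction `P / Q` with
`deg Q < deg q` is closer to `t / q` than `|X|^(-2 deg Q - G)`. -/
lemma natDegree_le_of_contMatrix (G : ℕ) (L : List k[X])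
    (hL : ∀ a ∈ L, 1 ≤ a.natDegree ∧ a.natDegree ≤ G) {Q : k[X]} (hQ : Q ≠ 0)
    (hQL : Q.natDegree < (contMatrix L 0 0).natDegree) (P : k[X]) :
    Q * contMatrix L 1 0 - P * contMatrix L 0 0 ≠ 0 ∧
      (contMatrix L 0 0).natDegree ≤
        (Q * contMatrix L 1 0 - P * contMatrix L 0 0).natDegree + Q.natDegree + G := by
  induction L generalizing Q P with
  | nil => simp [contMatrix_nil] at hQL
  | cons a L ih =>
    have hL1 : ∀ b ∈ L, 1 ≤ b.natDegree ∧ b.natDegree ≤ G :=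
      fun b hb => hL b (List.mem_cons_of_mem _ hb)
    obtain ⟨h0, -, h2⟩ := contMatrix_degree L fun b hb => (hL1 b hb).1
    have ha := hL a List.mem_cons_self
    have ha0 : a ≠ 0 := by rintro rfl; simp at ha
    have hq : (contMatrix (a :: L) 0 0).natDegree = a.natDegree + (contMatrix L 0 0).natDegree := by
      rw [(contMatrix_degree _ fun b hb => (hL b hb).1).2.1,
        (contMatrix_degree _ fun b hb => (hL1 b hb).1).2.1]
      simp
    rw [hq] at hQL ⊢
    rw [contMatrix_cons_zero, contMatrix_cons_one]
    set q := contMatrix L 0 0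
    set t := contMatrix L 1 0
    -- Only the case P = 0 uses the bound G on deg a: the difference is then Q q.
    by_cases hP : P = 0
    · subst hP
      rw [zero_mul, sub_zero, natDegree_mul hQ h0]
      exact ⟨mul_ne_zero hQ h0, by omega⟩
    have key : Q * q - P * (a * q + t) = -(P * t - (Q - P * a) * q) := by ring
    -- If deg Q < deg (P a), the term in q dominates and the difference is large. Otherwise deg P ≤
    -- deg Q - deg a, and one Euclidean step passes to the pair (P, Q - P a) for the tail.
    rcases lt_or_ge Q.natDegree (a.natDegree + P.natDegree) with hlt | hge
    · have hd : (Q - P * a).degree = (P * a).degree := by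
        rw [degree_sub_eq_right_of_degree_lt]
        rw [degree_eq_natDegree hQ, degree_eq_natDegree (mul_ne_zero hP ha0), natDegree_mul hP ha0]
        exact_mod_cast (by omega)
      have hd0 : Q - P * a ≠ 0 := by
        intro h
        rw [h, degree_zero] at hd
        exact mul_ne_zero hP ha0 (degree_eq_bot.1 hd.symm)
      have hdn := natDegree_eq_of_degree_eq hd
      rw [natDegree_mul hP ha0] at hdn
      have hlt2 : (P * t).degree < ((Q - P * a) * q).degree := by
        rw [degree_mul, degree_mul, hd, degree_mul]
        rw [degree_eq_natDegree hP, degree_eq_natDegree ha0]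
        rw [degree_eq_natDegree h0] at h2 ⊢
        by_cases ht : t = 0
        · rw [ht, degree_zero, WithBot.add_bot]
          exact WithBot.bot_lt_coe _
        rw [degree_eq_natDegree ht] at h2 ⊢
        norm_cast at h2 ⊢
        omega
      have hd2 := degree_sub_eq_right_of_degree_lt hlt2
      rw [key, natDegree_neg, neg_ne_zero, natDegree_eq_of_degree_eq hd2, natDegree_mul hd0 h0]
      refine ⟨?_, by omega⟩
      intro h
      rw [h, degree_zero] at hd2
      exact mul_ne_zero hd0 h0 (degree_eq_bot.1 hd2.symm)
    · obtain ⟨i1, i2⟩ := ih hL1 hP (by omega) (Q - P * a)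
      rw [key, natDegree_neg, neg_ne_zero]
      exact ⟨i1, by omega⟩

end ContinuedFraction

/-! ### The words of partial quotients and their continuants in characteristic 3. -/

section Word

open Polynomial

/-- The words whose limit is the sequence of partial quotients of the root of
`Z⁴ + Z² - X Z + 1`. -/
def quarticWord : ℕ → List (ZMod 3)[X]
  | 0 => []
  | 1 => X :: []
  | n + 2 => quarticWord (n + 1) ++
      (-X :: ((quarticWord n).map (frobenius (ZMod 3)[X] 3) ++ -X :: quarticWord (n + 1)))

/-- Cubing triples a degree but acts on the word two steps back, so the maximal degree grows like √3
per step; squaring avoids the root. -/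
lemma natDegree_of_mem_quarticWord (n : ℕ) :
    ∀ a ∈ quarticWord n, 1 ≤ a.natDegree ∧ a.natDegree ^ 2 ≤ 3 ^ n := by
  induction n using Nat.twoStepInduction with
  | zero => simp [quarticWord]
  | one => simp [quarticWord]
  | more n h0 h1 =>
    have hX : 1 ≤ (-X : (ZMod 3)[X]).natDegree ∧ (-X : (ZMod 3)[X]).natDegree ^ 2 ≤ 3 ^ (n + 2) := by
      rw [natDegree_neg, natDegree_X]
      exact ⟨le_rfl, by simpa using Nat.one_le_pow _ _ (by norm_num)⟩
    have h1' : ∀ a ∈ quarticWord (n + 1), 1 ≤ a.natDegree ∧ a.natDegree ^ 2 ≤ 3 ^ (n + 2) :=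
      fun a ha => ⟨(h1 a ha).1, (h1 a ha).2.trans (Nat.pow_le_pow_right (by norm_num) (by omega))⟩
    intro a ha
    simp only [quarticWord, List.mem_append, List.mem_cons, List.mem_map] at ha
    rcases ha with ha | rfl | ⟨b, hb, rfl⟩ | rfl | ha
    · exact h1' a ha
    · exact hX
    · obtain ⟨h2, h3⟩ := h0 b hb
      rw [frobenius_def, natDegree_pow]
      refine ⟨by omega, ?_⟩
      rw [pow_add, mul_pow]
      omega
    · exact hX
    · exact h1' a ha

lemma sum_natDegree_quarticWord (n : ℕ) :
    2 * ((quarticWord n).map natDegree).sum + 1 = 3 ^ n := by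
  induction n using Nat.twoStepInduction with
  | zero => simp [quarticWord]
  | one => simp [quarticWord]
  | more n h0 h1 =>
    have h2 : (((quarticWord n).map (frobenius (ZMod 3)[X] 3)).map natDegree).sum
        = 3 * ((quarticWord n).map natDegree).sum := by
      rw [List.map_map, ← List.sum_map_mul_left]
      congr 1
      exact List.map_congr_left fun b _ => by simp [frobenius_def, natDegree_pow]
    simp only [quarticWord, List.map_append, List.map_cons, List.sum_append, List.sum_cons, h2,
      natDegree_neg, natDegree_X]
    rw [pow_succ] at h1
    rw [pow_add]
    omega

lemma natDegree_contMatrix_quarticWord (n : ℕ) :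
    2 * (contMatrix (quarticWord n) 0 0).natDegree + 1 = 3 ^ n := by
  rw [(contMatrix_degree _ fun a ha => (natDegree_of_mem_quarticWord n a ha).1).2.1,
    sum_natDegree_quarticWord]

lemma contMatrix_quarticWord_add_two (n : ℕ) :
    contMatrix (quarticWord (n + 2)) = contMatrix (quarticWord (n + 1)) *
      (!![-X, 1; 1, 0] * ((contMatrix (quarticWord n)).map (frobenius (ZMod 3)[X] 3) *
        (!![-X, 1; 1, 0] * contMatrix (quarticWord (n + 1))))) := by
  rw [quarticWord, contMatrix_append, contMatrix_cons, contMatrix_append, contMatrix_map,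
    contMatrix_cons]

/-- The cubes of the entries of the `n`-th continuant matrix are linear in the entries of the
next one. -/
lemma exists_contMatrix_quarticWord (n : ℕ) : ∃ q₀ r₀ s₀ q r s ε : (ZMod 3)[X],
    contMatrix (quarticWord n) = !![q₀, r₀; r₀, s₀] ∧
    contMatrix (quarticWord (n + 1)) = !![q, r; r, s] ∧
    ε * ε = 1 ∧ q * s - r ^ 2 = ε ∧ s ^ 2 + r ^ 2 - X * q * r + q ^ 2 = -ε ∧
    q₀ ^ 3 = r ∧ r₀ ^ 3 = X * r - q - s ∧ s₀ ^ 3 = (X ^ 2 + 1) * r - X * q + X * s := by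
  have h3 : (3 : (ZMod 3)[X]) = 0 := CharP.cast_eq_zero (ZMod 3)[X] 3
  induction n with
  | zero =>
    refine ⟨1, 0, 1, X, 1, 0, -1, ?_, ?_, ?_, ?_, ?_, ?_, ?_, ?_⟩
    · rw [quarticWord, contMatrix_nil, Matrix.one_fin_two]
    · rw [zero_add, quarticWord, contMatrix_cons, contMatrix_nil, mul_one]
    all_goals ring
  | succ n ih =>
    obtain ⟨q₀, r₀, s₀, q, r, s, ε, hM₀, hM, hε, hD, hN, hq, hr, hs⟩ := ih
    -- These are the diagonal entries of the next matrix, simplified by the relations and 3 = 0.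
    set q' := X * q ^ 3 - q * r * s - r * q ^ 2 - r * ε with hq'
    set s' := r * q ^ 2 + r ^ 3 - r * q * s with hs'
    have hr₁ : r ^ 3 = X * q ^ 3 - q' - s' := by
      linear_combination (-2 * r) * hD - r * ε * h3
    have hs₁ : s ^ 3 = (X ^ 2 + 1) * q ^ 3 - X * q' + X * s' := by
      linear_combination (X * r + 2 * q + s) * hD + (2 * q + s) * hN -
        (q * s ^ 2 + q ^ 2 * s + q ^ 3) * h3
    have hM' : contMatrix (quarticWord (n + 2)) = !![q', q ^ 3; q ^ 3, s'] := by
      rw [contMatrix_quarticWord_add_two, hM, hM₀]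
      refine Matrix.ext fun i j => ?_
      fin_cases i <;> fin_cases j <;>
        simp only [Matrix.mul_apply, Fin.sum_univ_two, Matrix.map_apply, frobenius_def,
          Fin.zero_eta, Fin.mk_one, Fin.isValue, Matrix.of_apply, Matrix.cons_val',
          Matrix.cons_val_zero,
          Matrix.cons_val_one, Matrix.cons_val_fin_one, hq, hr, hs]
      · linear_combination -r * hD + q ^ 2 * (X * s) * h3
      · linear_combination -q * hD - q * hN + q * r * (X * s) * h3
      · linear_combination -q * hD - q * hN + q * r * (X * s) * h3
      · linear_combination -r * hD - r * hN + r ^ 2 * (X * s) * h3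
    have hdet : q ^ 3 * s ^ 3 - (r ^ 3) ^ 2 = ε := by
      have : q ^ 3 * s ^ 3 - (r ^ 3) ^ 2 = (q * s - r ^ 2) ^ 3 := by
        linear_combination (q * s * r ^ 2 * (q * s - r ^ 2)) * h3
      rw [this, hD]
      linear_combination ε * hε
    -- Determinants are multiplicative: the outer factors give ε² = 1, and the cubed determinant of
    -- the previous matrix, written in q, r, s, equals -ε by `hK`.
    have hD' : q' * s' - (q ^ 3) ^ 2 = -ε := by
      have h := congrArg Matrix.det hM'
      rw [contMatrix_quarticWord_add_two, hM, hM₀, ← RingHom.mapMatrix_apply, Matrix.det_mul,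
        Matrix.det_mul, Matrix.det_mul, Matrix.det_mul, ← RingHom.map_det] at h
      simp only [Matrix.det_fin_two_of, map_sub, map_mul, frobenius_def, hq, hr, hs] at h
      have hK : r * ((X ^ 2 + 1) * r - X * q + X * s) - (X * r - q - s) * (X * r - q - s) = -ε := by
        linear_combination hD - hN + (X * r * s + r ^ 2 - q * s + ε) * h3
      have hD₁ : q * s - r * r = ε := by rw [← hD]; ring
      rw [hK, hD₁] at h
      linear_combination -h - ε * hε
    refine ⟨q, r, s, q', q ^ 3, s', -ε, hM, hM', by rw [neg_mul_neg, hε], hD', ?_, rfl, hr₁, hs₁⟩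
    -- The quadratic relation at the next level is the cube of the current determinant relation,
    -- read through the linear formulas for the cubes.
    rw [hr₁, hs₁] at hdet
    linear_combination hD' - hdet + (X * q ^ 3 * s' + (q ^ 3) ^ 2 - q' * s' - ε) * h3

end Word

/-! ### Existence, uniqueness and size of the root. -/

section Root

/-- The roots of `Z⁴ + Z² - X Z + 1` in `k((X⁻¹))`. -/
def IsQuarticRoot {k : Type*} [Field k] (Θ : SeriesAtInfinity k) : Prop :=
  Θ ^ 4 + Θ ^ 2 - seriesX k * Θ + 1 = 0

variable {k : Type*} [Field k]

/-- With u = X⁻¹ and Θ = u/v the equation becomes v⁴ - v³ + u²v² + u⁴ = 0 over k⟦u⟧. Modulo u it has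
the simple root 1, which Hensel's lemma lifts. -/
lemma exists_isQuarticRoot : ∃ Θ : SeriesAtInfinity k, IsQuarticRoot Θ := by
  let u : PowerSeries k := PowerSeries.X
  let f : Polynomial (PowerSeries k) := .X ^ 4 - .X ^ 3 + .C (u ^ 2) * .X ^ 2 + .C (u ^ 4)
  have hf : f.Monic := by
    simp only [f]
    monicity!
  have hu : ∀ n : ℕ, n ≠ 0 → u ^ n ∈ Ideal.span {u} := fun n hn =>
    Ideal.mem_span_singleton.2 (dvd_pow_self u hn)
  have h1 : f.eval 1 ∈ Ideal.span {u} := by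
    simpa [f] using Ideal.add_mem _ (hu 2 two_ne_zero) (hu 4 four_ne_zero)
  have h2 : IsUnit (Ideal.Quotient.mk (Ideal.span {u}) (f.derivative.eval 1)) := by
    have : f.derivative.eval 1 - 1 ∈ Ideal.span {u} := by
      have h : f.derivative.eval 1 - 1 = u * (u * 2) := by
        simp [f, Polynomial.derivative_pow]
        ring
      rw [h]
      exact Ideal.mul_mem_right _ _ (Ideal.mem_span_singleton_self u)
    rw [(Ideal.Quotient.eq.2 this), map_one]
    exact isUnit_one
  obtain ⟨v, hv, hv1⟩ := HenselianRing.is_henselian f hf 1 h1 h2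
  have hv0 : v ≠ 0 := by
    rintro rfl
    obtain ⟨c, hc⟩ := Ideal.mem_span_singleton.1 hv1
    have := congrArg (PowerSeries.constantCoeff (R := k)) hc
    simp [u] at this
  have hv2 : v ^ 4 - v ^ 3 + u ^ 2 * v ^ 2 + u ^ 4 = 0 := by
    simpa [f, Polynomial.IsRoot] using hv
  let φ := HahnSeries.ofPowerSeries ℤ k
  have hφ : φ v ≠ 0 := by
    intro h
    exact hv0 (HahnSeries.ofPowerSeries_injective (h.trans (map_zero φ).symm))
  have hX : seriesX k * φ u = 1 := by
    simp only [φ, u, HahnSeries.ofPowerSeries_X, seriesX, HahnSeries.single_mul_single]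
    simp
  have hφv := congrArg φ hv2
  simp only [map_add, map_sub, map_mul, map_pow, map_zero] at hφv
  refine ⟨φ u / φ v, ?_⟩
  rw [IsQuarticRoot]
  field_simp
  linear_combination hφv - φ v ^ 3 * hX

lemma IsQuarticRoot.ne_zero {Θ : SeriesAtInfinity k} (hΘ : IsQuarticRoot Θ) : Θ ≠ 0 := by
  rintro rfl
  simp [IsQuarticRoot] at hΘ

/-- If |Θ| > 1, then Θ⁴ dominates and |Θ|³ = 2, which is not the cube of an integral power of 2. So
|Θ| ≤ 1, and then in XΘ = 1 + Θ² + Θ⁴ the 1 dominates. -/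
lemma IsQuarticRoot.absInf_eq {Θ : SeriesAtInfinity k} (hΘ : IsQuarticRoot Θ) :
    absInf Θ = 1 / 2 := by
  have h0 : 0 < absInf Θ := absInf_pos hΘ.ne_zero
  have hX : 2 * absInf Θ = absInf (Θ ^ 4 + (Θ ^ 2 + 1)) := by
    rw [← absInf_seriesX (k := k), ← absInf_mul]
    rw [IsQuarticRoot] at hΘ
    congr 1
    linear_combination -hΘ
  have hle : absInf Θ ≤ 1 := by
    by_contra! hlt
    have h2 : absInf (Θ ^ 2 + 1) ≤ absInf Θ ^ 2 :=
      absInf_add_le (absInf_pow _ _).le (absInf_one.le.trans (one_le_pow₀ hlt.le))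
    rw [absInf_add_eq_left (by
      rw [absInf_pow]
      exact h2.trans_lt (pow_lt_pow_right₀ hlt (by norm_num))), absInf_pow] at hX
    have h3 : absInf Θ ^ 3 = 2 := by
      have : absInf Θ * (absInf Θ ^ 3 - 2) = 0 := by linear_combination -hX
      rcases mul_eq_zero.1 this with h | h <;> linarith
    rw [absInf_of_ne_zero hΘ.ne_zero, ← zpow_natCast, ← zpow_mul] at h3
    have := zpow_right_injective₀ (two_pos (α := ℝ)) (by norm_num) (h3.trans (zpow_one 2).symm)
    omega
  have h1 : absInf (Θ ^ 4 + (Θ ^ 2 + 1)) ≤ 1 :=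
    absInf_add_le (by rw [absInf_pow]; exact pow_le_one₀ h0.le hle)
      (absInf_add_le (by rw [absInf_pow]; exact pow_le_one₀ h0.le hle) absInf_one.le)
  have h2 : absInf Θ ≤ 1 / 2 := by linarith
  have h3 : ∀ n : ℕ, n ≠ 0 → absInf (Θ ^ n) < 1 := fun n hn => by
    rw [absInf_pow]
    exact pow_lt_one₀ h0.le (by linarith) hn
  rw [show Θ ^ 4 + (Θ ^ 2 + 1) = 1 + (Θ ^ 2 + Θ ^ 4) by ring, absInf_add_eq_left, absInf_one] at hX
  · linarith
  · rw [absInf_one]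
    exact (absInf_add_le_max _ _).trans_lt (max_lt (h3 2 two_ne_zero) (h3 4 four_ne_zero))

/-- The difference of the two equations factors through Θ - Θ', with a cofactor in which X
dominates. -/
lemma IsQuarticRoot.eq {Θ Θ' : SeriesAtInfinity k} (hΘ : IsQuarticRoot Θ)
    (hΘ' : IsQuarticRoot Θ') : Θ = Θ' := by
  have hs : absInf (Θ + Θ') ≤ 1 :=
    absInf_add_le (hΘ.absInf_eq.le.trans (by norm_num)) (hΘ'.absInf_eq.le.trans (by norm_num))
  have hs2 : absInf (Θ ^ 2 + Θ' ^ 2) ≤ 1 :=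
    absInf_add_le (by rw [absInf_pow, hΘ.absInf_eq]; norm_num)
      (by rw [absInf_pow, hΘ'.absInf_eq]; norm_num)
  have hle : absInf ((Θ + Θ') * (Θ ^ 2 + Θ' ^ 2) + (Θ + Θ')) ≤ 1 :=
    absInf_add_le (by rw [absInf_mul]; exact mul_le_one₀ hs (absInf_nonneg _) hs2) hs
  have hne : seriesX k - ((Θ + Θ') * (Θ ^ 2 + Θ' ^ 2) + (Θ + Θ')) ≠ 0 := by
    intro h
    rw [sub_eq_zero] at h
    rw [← h, absInf_seriesX] at hle
    norm_num at hle
  rw [IsQuarticRoot] at hΘ hΘ'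
  have : (Θ - Θ') * (seriesX k - ((Θ + Θ') * (Θ ^ 2 + Θ' ^ 2) + (Θ + Θ'))) = 0 := by
    linear_combination hΘ' - hΘ
  exact sub_eq_zero.1 ((mul_eq_zero.1 this).resolve_right hne)

/-- If `q s - r²` and `s² + r² - X q r + q²` are opposite units, then `r / q` is a convergent
of the root. -/
lemma IsQuarticRoot.absInf_mul_sub_le {Θ : SeriesAtInfinity k} (hΘ : IsQuarticRoot Θ)
    {q r s ε : SeriesAtInfinity k} (hε : ε * ε = 1) (hD : q * s - r ^ 2 = ε)
    (hN : s ^ 2 + r ^ 2 - seriesX k * q * r + q ^ 2 = -ε) (hq : 1 ≤ absInf q)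
    (hr : absInf r ≤ absInf q) :
    absInf (q * Θ - r) ≤ 1 / (2 * absInf q) := by
  have hε1 : absInf ε = 1 := by
    have h := congrArg absInf hε
    rw [absInf_mul, absInf_one] at h
    nlinarith [absInf_nonneg ε]
  have hq0 : 0 < absInf q := by linarith
  have hΘq : absInf (q * Θ) ≤ absInf q := by
    rw [absInf_mul, hΘ.absInf_eq]; linarith
  -- With f the quartic, both sides equal q⁴ f(r/q): the left by factoring f(Θ) - f(r/q), the right
  -- by eliminating s.
  have key : (q * Θ - r) * (seriesX k * q ^ 3 -
      ((q * Θ + r) * ((q * Θ) ^ 2 + r ^ 2) + q ^ 2 * (q * Θ + r))) =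
      -ε * q ^ 2 - (ε * r ^ 2 + (ε * r ^ 2 + 1)) := by
    rw [IsQuarticRoot] at hΘ
    linear_combination (-q ^ 4) * hΘ + q ^ 2 * hN - (q * s + r ^ 2 + ε) * hD - hε
  have hsum : absInf (q * Θ + r) ≤ absInf q := absInf_add_le hΘq hr
  have hsq : absInf ((q * Θ) ^ 2 + r ^ 2) ≤ absInf q ^ 2 :=
    absInf_add_le (by rw [absInf_pow]; exact pow_le_pow_left₀ (absInf_nonneg _) hΘq 2)
      (by rw [absInf_pow]; exact pow_le_pow_left₀ (absInf_nonneg _) hr 2)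
  have hinner : absInf ((q * Θ + r) * ((q * Θ) ^ 2 + r ^ 2) + q ^ 2 * (q * Θ + r)) ≤
      absInf q ^ 3 := by
    apply absInf_add_le
    · rw [absInf_mul, pow_succ' _ 2]
      exact mul_le_mul hsum hsq (absInf_nonneg _) hq0.le
    · rw [absInf_mul, absInf_pow, pow_succ]
      exact mul_le_mul_of_nonneg_left hsum (by positivity)
  have hbr : absInf (seriesX k * q ^ 3 -
      ((q * Θ + r) * ((q * Θ) ^ 2 + r ^ 2) + q ^ 2 * (q * Θ + r))) = 2 * absInf q ^ 3 := by
    have hX : absInf (seriesX k * q ^ 3) = 2 * absInf q ^ 3 := by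
      rw [absInf_mul, absInf_pow, absInf_seriesX]
    rw [absInf_sub_eq_left, hX]
    rw [hX]
    have : 0 < absInf q ^ 3 := by positivity
    linarith
  have hεr : absInf (ε * r ^ 2) ≤ absInf q ^ 2 := by
    rw [absInf_mul, hε1, one_mul, absInf_pow]
    exact pow_le_pow_left₀ (absInf_nonneg _) hr 2
  have hrhs : absInf (-ε * q ^ 2 - (ε * r ^ 2 + (ε * r ^ 2 + 1))) ≤ absInf q ^ 2 := by
    refine absInf_sub_le ?_ (absInf_add_le hεr (absInf_add_le hεr ?_))
    · rw [absInf_mul, absInf_neg, hε1, one_mul, absInf_pow]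
    · rw [absInf_one]
      exact one_le_pow₀ hq
  rw [← key, absInf_mul, hbr] at hrhs
  rw [le_div_iff₀ (by positivity)]
  have h4 : 0 < absInf q ^ 2 := by positivity
  refine le_of_mul_le_mul_right ?_ h4
  linarith

end Root

/-! ### Upper and lower bounds for the product. -/

section Approximation

open Polynomial

lemma IsQuarticRoot.exists_convergent {Θ : SeriesAtInfinity (ZMod 3)} (hΘ : IsQuarticRoot Θ)
    (n : ℕ) : ∃ q r s ε : (ZMod 3)[X],
      contMatrix (quarticWord (n + 1)) = !![q, r; r, s] ∧ q ≠ 0 ∧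
      r = contMatrix (quarticWord n) 0 0 ^ 3 ∧ ε * ε = 1 ∧ q * s - r ^ 2 = ε ∧
      absInf (ofPoly q * Θ - ofPoly r) ≤ 1 / (2 * absInf (ofPoly q)) := by
  obtain ⟨q₀, r₀, s₀, q, r, s, ε, hM₀, hM, hε, hD, hN, hq, -, -⟩ := exists_contMatrix_quarticWord n
  obtain ⟨h0, -, hlt⟩ := contMatrix_degree (quarticWord (n + 1))
    fun a ha => (natDegree_of_mem_quarticWord _ a ha).1
  rw [hM] at h0 hlt
  change q ≠ 0 at h0
  change r.degree < q.degree at hlt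
  refine ⟨q, r, s, ε, hM, h0, by rw [hM₀, ← hq]; rfl, hε, hD, ?_⟩
  refine hΘ.absInf_mul_sub_le (s := ofPoly s) (ε := ofPoly ε) ?_ ?_ ?_ ?_ ?_
  · rw [← map_mul, hε, map_one]
  · rw [← hD]; simp
  · rw [← map_neg, ← hN, ← ofPoly_X]; simp
  · rw [absInf_ofPoly h0]; exact one_le_pow₀ one_le_two
  · rw [absInf_ofPoly h0]
    exact (absInf_ofPoly_le r).trans
      (pow_le_pow_right₀ one_le_two (natDegree_le_natDegree hlt.le))

lemma IsQuarticRoot.absInf_mul_inv_sub {k : Type*} [Field k] {Θ : SeriesAtInfinity k}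
    (hΘ : IsQuarticRoot Θ) (F G : SeriesAtInfinity k) :
    absInf (F * Θ⁻¹ - G) = 2 * absInf (G * Θ - F) := by
  have h : F * Θ⁻¹ - G = -((G * Θ - F) * Θ⁻¹) := by
    have := hΘ.ne_zero
    field_simp
    ring
  rw [h, absInf_neg, absInf_mul, absInf_inv, hΘ.absInf_eq]
  ring

/-- There are `Q` of arbitrarily large degree with `|Q|² ‖Q Θ‖ ‖Q Θ⁻¹‖ ≤ 1`. -/
lemma IsQuarticRoot.exists_le_one {Θ : SeriesAtInfinity (ZMod 3)} (hΘ : IsQuarticRoot Θ)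
    (N : ℕ) : ∃ Q : (ZMod 3)[X], N ≤ Q.natDegree ∧
      absInf (ofPoly Q) ^ 2 * distPoly (ofPoly Q * Θ) * distPoly (ofPoly Q * Θ⁻¹) ≤ 1 := by
  obtain ⟨q, r, s, ε, hM, hq, hr, hε, hD, happ⟩ := hΘ.exists_convergent (N + 1)
  obtain ⟨h0, -, hlt⟩ := contMatrix_degree (quarticWord (N + 2))
    fun a ha => (natDegree_of_mem_quarticWord _ a ha).1
  rw [hM] at hlt
  change r.degree < q.degree at hlt
  have hd0 := natDegree_contMatrix_quarticWord (N + 1)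
  have hd : N + 1 ≤ r.natDegree := by
    rw [hr, natDegree_pow]
    have : N + 1 < 3 ^ (N + 1) := Nat.lt_pow_self (by norm_num)
    omega
  have hr0 : r ≠ 0 := by rintro rfl; simp at hd
  have hrq : r.natDegree < q.natDegree := natDegree_lt_natDegree hr0 hlt
  have hr2 : absInf (ofPoly r) ≤ absInf (ofPoly q) / 2 := by
    rw [absInf_ofPoly hr0, absInf_ofPoly hq, le_div_iff₀ two_pos, ← pow_succ]
    exact pow_le_pow_right₀ one_le_two hrq
  have hr1 : 2 ≤ absInf (ofPoly r) := by
    rw [absInf_ofPoly hr0]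
    calc (2 : ℝ) = 2 ^ 1 := (pow_one 2).symm
      _ ≤ _ := pow_le_pow_right₀ one_le_two (by omega)
  have hq0 : 0 < absInf (ofPoly q) := by linarith
  have hε1 : absInf (ofPoly ε) = 1 := by
    have h := congrArg (fun p : (ZMod 3)[X] => absInf (ofPoly p)) hε
    simp only [map_mul, absInf_mul, map_one, absInf_one] at h
    nlinarith [absInf_nonneg (ofPoly ε)]
  have hinv : absInf (ofPoly r * Θ⁻¹ - ofPoly q) ≤ 1 / absInf (ofPoly q) := by
    rw [hΘ.absInf_mul_inv_sub]
    calc _ ≤ 2 * (1 / (2 * absInf (ofPoly q))) := by linarith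
      _ = _ := by field_simp
  -- Multiplying rΘ - s by q and using qs = r² + ε reduces this to the estimate for qΘ - r.
  have hdir : absInf (ofPoly r * Θ - ofPoly s) ≤ 1 / absInf (ofPoly q) := by
    rw [le_div_iff₀ hq0, ← absInf_mul]
    have h : (ofPoly r * Θ - ofPoly s) * ofPoly q =
        ofPoly r * (ofPoly q * Θ - ofPoly r) - ofPoly ε := by
      rw [← hD]; simp; ring
    rw [h]
    refine absInf_sub_le ?_ hε1.le
    rw [absInf_mul]
    calc _ ≤ absInf (ofPoly q) / 2 * (1 / (2 * absInf (ofPoly q))) :=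
          mul_le_mul hr2 happ (absInf_nonneg _) (by positivity)
      _ = 1 / 4 := by field_simp; norm_num
      _ ≤ 1 := by norm_num
  have hlt1 : 1 / absInf (ofPoly q) < 1 := by
    rw [div_lt_one hq0]; linarith
  refine ⟨r, by omega, ?_⟩
  rw [distPoly_eq (hinv.trans_lt hlt1), distPoly_eq (hdir.trans_lt hlt1), mul_assoc]
  calc _ ≤ (absInf (ofPoly q) / 2) ^ 2 * (1 / absInf (ofPoly q) * (1 / absInf (ofPoly q))) := by
        gcongr
        · exact mul_nonneg (absInf_nonneg _) (absInf_nonneg _)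
        all_goals exact absInf_nonneg _
    _ = 1 / 4 := by field_simp; norm_num
    _ ≤ 1 := by norm_num

/-- A lower bound for the distance of `Q Θ` to the polynomials. -/
lemma IsQuarticRoot.le_absInf_mul_sub {Θ : SeriesAtInfinity (ZMod 3)} (hΘ : IsQuarticRoot Θ)
    {Q : (ZMod 3)[X]} (hQ : 1 ≤ Q.natDegree) : ∃ G : ℕ, G ^ 2 ≤ 15 * Q.natDegree ∧
      ∀ P : (ZMod 3)[X], 1 ≤ absInf (ofPoly Q * Θ - ofPoly P) * 2 ^ (Q.natDegree + G) := by
  have hQ0 : Q ≠ 0 := by rintro rfl; simp at hQ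
  -- The factor 4 makes the denominator, of degree (3^m - 1)/2, have degree at least 2 deg Q;
  -- minimality of m keeps 3^m, and so G², at most 15 deg Q.
  have hex : ∃ n : ℕ, 4 * Q.natDegree + 1 ≤ 3 ^ n :=
    ⟨4 * Q.natDegree + 1, (Nat.lt_pow_self (by norm_num)).le⟩
  classical
  obtain ⟨n, hn⟩ : ∃ n, Nat.find hex = n + 1 := by
    refine Nat.exists_eq_succ_of_ne_zero fun h => ?_
    have := Nat.find_spec hex
    rw [h] at this
    omega
  have hle : 4 * Q.natDegree + 1 ≤ 3 ^ (n + 1) := hn ▸ Nat.find_spec hex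
  have hgt : 3 ^ n < 4 * Q.natDegree + 1 := by
    have := Nat.find_min hex (m := n) (by omega)
    omega
  have hdeg := natDegree_contMatrix_quarticWord (n + 1)
  have hG := Nat.sqrt_le' (3 ^ (n + 1))
  set G := Nat.sqrt (3 ^ (n + 1)) with hGdef
  obtain ⟨q, r, s, ε, hM, hq, -, -, -, happ⟩ := hΘ.exists_convergent n
  refine ⟨G, by rw [pow_succ 3 n] at hG; omega, fun P => ?_⟩
  have hgap := natDegree_le_of_contMatrix G (quarticWord (n + 1)) (fun a ha =>
    ⟨(natDegree_of_mem_quarticWord _ a ha).1, by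
      rw [hGdef, Nat.le_sqrt']
      exact (natDegree_of_mem_quarticWord _ a ha).2⟩) hQ0 (by omega) P
  rw [hM] at hgap hdeg
  change Q * r - P * q ≠ 0 ∧ q.natDegree ≤ (Q * r - P * q).natDegree + Q.natDegree + G at hgap
  change 2 * q.natDegree + 1 = _ at hdeg
  obtain ⟨hne, hgap⟩ := hgap
  have hGq : G < 2 * q.natDegree + 1 := by
    rw [hdeg]
    refine Nat.sqrt_lt_self ?_
    exact Nat.one_lt_pow (by omega) (by norm_num)
  have hq0 : 0 < absInf (ofPoly q) := absInf_pos (ofPoly_ne_zero hq)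
  have hqP : absInf (ofPoly (Q * r - P * q)) ≤
      absInf (ofPoly Q * Θ - ofPoly P) * absInf (ofPoly q) := by
    have h : (ofPoly Q * Θ - ofPoly P) * ofPoly q =
        ofPoly (Q * r - P * q) + ofPoly Q * (ofPoly q * Θ - ofPoly r) := by
      simp; ring
    rw [← absInf_mul, h]
    -- Replacing Θ by r/q costs less than 1, while a nonzero polynomial has absolute value at least
    -- 1.
    refine (absInf_add_eq_left ?_).ge
    calc absInf (ofPoly Q * (ofPoly q * Θ - ofPoly r))
        ≤ 2 ^ Q.natDegree * (1 / (2 * 2 ^ q.natDegree)) := by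
          rw [absInf_mul]
          rw [absInf_ofPoly hq] at happ
          exact mul_le_mul (absInf_ofPoly_le Q) happ (absInf_nonneg _) (by positivity)
      _ < 1 := by
          rw [mul_one_div, div_lt_one (by positivity), ← pow_succ']
          exact pow_lt_pow_right₀ one_lt_two (by omega)
      _ ≤ absInf (ofPoly (Q * r - P * q)) := by
          rw [absInf_ofPoly hne]
          exact one_le_pow₀ one_le_two
  refine le_of_mul_le_mul_right ?_ hq0
  calc 1 * absInf (ofPoly q) ≤ 2 ^ (Q * r - P * q).natDegree * 2 ^ (Q.natDegree + G) := by
        rw [one_mul, absInf_ofPoly hq, ← pow_add]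
        exact pow_le_pow_right₀ one_le_two (by omega)
    _ ≤ absInf (ofPoly Q * Θ - ofPoly P) * absInf (ofPoly q) * 2 ^ (Q.natDegree + G) := by
        rw [← absInf_ofPoly hne]
        gcongr
    _ = _ := by ring

lemma IsQuarticRoot.le_distPoly_mul {Θ : SeriesAtInfinity (ZMod 3)} (hΘ : IsQuarticRoot Θ)
    {Q : (ZMod 3)[X]} (hQ : 1 ≤ Q.natDegree) : ∃ G : ℕ, G ^ 2 ≤ 15 * Q.natDegree ∧
      (2 : ℝ) ^ (-(Q.natDegree + G : ℝ)) ≤ distPoly (ofPoly Q * Θ) := by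
  obtain ⟨G, hG, h⟩ := hΘ.le_absInf_mul_sub hQ
  obtain ⟨P, hP, -⟩ := exists_distPoly_eq (ofPoly Q * Θ)
  refine ⟨G, hG, ?_⟩
  rw [hP, Real.rpow_neg two_pos.le, inv_le_iff_one_le_mul₀ (by positivity)]
  exact_mod_cast h P

lemma IsQuarticRoot.le_distPoly_mul_inv {Θ : SeriesAtInfinity (ZMod 3)} (hΘ : IsQuarticRoot Θ)
    {Q : (ZMod 3)[X]} (hQ : 1 ≤ Q.natDegree) : ∃ G : ℕ, G ^ 2 ≤ 15 * (Q.natDegree + 1) ∧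
      (2 : ℝ) ^ (-(Q.natDegree + G : ℝ)) ≤ distPoly (ofPoly Q * Θ⁻¹) := by
  have hQ0 : Q ≠ 0 := by rintro rfl; simp at hQ
  obtain ⟨P, hP, hP1⟩ := exists_distPoly_eq (ofPoly Q * Θ⁻¹)
  have habs : absInf (ofPoly P) = 2 ^ (Q.natDegree + 1) := by
    have h1 : absInf (ofPoly Q * Θ⁻¹) = 2 ^ (Q.natDegree + 1) := by
      rw [absInf_mul, absInf_inv, hΘ.absInf_eq, absInf_ofPoly hQ0, pow_succ]
      norm_num
    rw [← h1, show ofPoly P = ofPoly Q * Θ⁻¹ - (ofPoly Q * Θ⁻¹ - ofPoly P) by ring]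
    refine absInf_sub_eq_left (hP1.trans_le ?_)
    rw [h1]
    exact one_le_pow₀ one_le_two
  have hP0 : P ≠ 0 := by
    rintro rfl
    rw [map_zero, absInf_zero] at habs
    exact (pow_pos two_pos _).ne habs
  have hPd : P.natDegree = Q.natDegree + 1 := by
    rw [absInf_ofPoly hP0] at habs
    exact pow_right_injective₀ two_pos (by norm_num) habs
  -- The roles of P and Q are exchanged: deg P = deg Q + 1, and this extra factor 2 is cancelled by
  -- |Θ⁻¹| = 2.
  obtain ⟨G, hG, h⟩ := hΘ.le_absInf_mul_sub (Q := P) (by omega)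
  rw [hPd] at hG h
  refine ⟨G, hG, ?_⟩
  rw [hP, hΘ.absInf_mul_inv_sub, Real.rpow_neg two_pos.le, inv_le_iff_one_le_mul₀ (by positivity)]
  refine (h Q).trans_eq ?_
  have : (2 : ℝ) ^ (Q.natDegree + G : ℝ) = 2 ^ (Q.natDegree + G) := by exact_mod_cast rfl
  rw [this]
  ring

/-- The threshold 120/ε² makes 30d ≤ (εd/2)²; the 30 covers both 15d and 15(d + 1). -/
lemma le_mul_of_sq_le {G d ε : ℝ} (hε : 0 < ε) (hd : 1 ≤ d) (hG : G ^ 2 ≤ 30 * d)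
    (hεd : 120 / ε ^ 2 ≤ d) : G ≤ ε / 2 * d := by
  rw [div_le_iff₀ (by positivity)] at hεd
  refine le_of_sq_le_sq ?_ (by positivity)
  nlinarith

/-- The root is not very well approximable, and neither is its inverse. -/
lemma IsQuarticRoot.one_le {Θ : SeriesAtInfinity (ZMod 3)} (hΘ : IsQuarticRoot Θ) {ε : ℝ}
    (hε : 0 < ε) {Q : (ZMod 3)[X]} (hQ : 1 ≤ Q.natDegree) (hQε : 120 / ε ^ 2 ≤ Q.natDegree)
    {c : ℝ} (hc : 0 ≤ c) :
    1 ≤ absInf (ofPoly Q) ^ (2 + c + ε) * distPoly (ofPoly Q * Θ) * distPoly (ofPoly Q * Θ⁻¹) := by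
  have hQ0 : Q ≠ 0 := by rintro rfl; simp at hQ
  obtain ⟨G₁, hG₁, h₁⟩ := hΘ.le_distPoly_mul hQ
  obtain ⟨G₂, hG₂, h₂⟩ := hΘ.le_distPoly_mul_inv hQ
  have hQ1 : (1 : ℝ) ≤ Q.natDegree := by exact_mod_cast hQ
  have hG₁' : (G₁ : ℝ) ≤ ε / 2 * Q.natDegree := by
    refine le_mul_of_sq_le hε hQ1 ?_ hQε
    have : (G₁ : ℝ) ^ 2 ≤ 15 * Q.natDegree := by exact_mod_cast hG₁
    linarith
  have hG₂' : (G₂ : ℝ) ≤ ε / 2 * Q.natDegree := by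
    refine le_mul_of_sq_le hε hQ1 ?_ hQε
    have : (G₂ : ℝ) ^ 2 ≤ 15 * (Q.natDegree + 1) := by exact_mod_cast hG₂
    linarith
  calc (1 : ℝ) ≤ 2 ^ (Q.natDegree * (2 + c + ε) + -(Q.natDegree + G₁ : ℝ) +
        -(Q.natDegree + G₂ : ℝ)) := by
        refine Real.one_le_rpow one_le_two ?_
        -- The exponent is d(c + ε) - G₁ - G₂, where each Gᵢ is at most εd/2.
        nlinarith [mul_nonneg (Nat.cast_nonneg (α := ℝ) Q.natDegree) hc]
    _ = absInf (ofPoly Q) ^ (2 + c + ε) * 2 ^ (-(Q.natDegree + G₁ : ℝ)) *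
          2 ^ (-(Q.natDegree + G₂ : ℝ)) := by
        rw [Real.rpow_add two_pos, Real.rpow_add two_pos, Real.rpow_mul two_pos.le,
          Real.rpow_natCast, absInf_ofPoly hQ0]
    _ ≤ _ := by
        have : 0 ≤ absInf (ofPoly Q) := absInf_nonneg _
        have : 0 ≤ distPoly (ofPoly Q * Θ) := absInf_nonneg _
        gcongr

end Approximation

end PowerSeriesField
end

theorem theorem9 :
    -- the polynomial `Z⁴ + Z² - X Z + 1` has a unique root in `𝔽₃((X⁻¹))`
    (∃! Θ : PowerSeriesField.SeriesAtInfinity (ZMod 3),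
      Θ ^ 4 + Θ ^ 2 - PowerSeriesField.seriesX (ZMod 3) * Θ + 1 = 0) ∧
    ∀ Θ : PowerSeriesField.SeriesAtInfinity (ZMod 3),
      Θ ^ 4 + Θ ^ 2 - PowerSeriesField.seriesX (ZMod 3) * Θ + 1 = 0 →
      -- the infimum over nonzero `q` is finite
      (⨅ q : {q : Polynomial (ZMod 3) // q ≠ 0},
        ENNReal.ofReal
          (PowerSeriesField.absInf (PowerSeriesField.ofPoly q.1) ^ 2 *
            PowerSeriesField.distPoly (PowerSeriesField.ofPoly q.1 * Θ) *
            PowerSeriesField.distPoly (PowerSeriesField.ofPoly q.1 * Θ⁻¹))) < ⊤ ∧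
      -- the lower limit as `deg q → ∞` is finite
      liminf (fun q : Polynomial (ZMod 3) =>
        ENNReal.ofReal
          (PowerSeriesField.absInf (PowerSeriesField.ofPoly q) ^ 2 *
            PowerSeriesField.distPoly (PowerSeriesField.ofPoly q * Θ) *
            PowerSeriesField.distPoly (PowerSeriesField.ofPoly q * Θ⁻¹)))
        (comap Polynomial.natDegree atTop) < ⊤ ∧
      -- the lower bound for all `q` of large degree
      ∀ ε : ℝ, 0 < ε → ∃ D : ℕ, ∀ q : Polynomial (ZMod 3), D ≤ q.natDegree →
        1 ≤ PowerSeriesField.absInf (PowerSeriesField.ofPoly q) ^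
              (2 + 4 / Real.sqrt (3 * (q.natDegree : ℝ)) + ε) *
            PowerSeriesField.distPoly (PowerSeriesField.ofPoly q * Θ) *
            PowerSeriesField.distPoly (PowerSeriesField.ofPoly q * Θ⁻¹) := by
  obtain ⟨Θ₀, hΘ₀⟩ := PowerSeriesField.exists_isQuarticRoot (k := ZMod 3)
  refine ⟨⟨Θ₀, hΘ₀, fun Θ hΘ => PowerSeriesField.IsQuarticRoot.eq hΘ hΘ₀⟩, fun Θ hΘ => ?_⟩
  replace hΘ : PowerSeriesField.IsQuarticRoot Θ := hΘ
  refine ⟨?_, ?_, fun ε hε => ?_⟩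
  -- Every value is a finite real, so the single choice q = 1 suffices.
  · exact (iInf_le _ ⟨1, one_ne_zero⟩).trans_lt ENNReal.ofReal_lt_top
  · refine (liminf_le_of_frequently_le' (x := (1 : ENNReal)) ?_).trans_lt ENNReal.one_lt_top
    rw [(atTop_basis.comap _).frequently_iff]
    intro N _
    obtain ⟨Q, hQ, h⟩ := hΘ.exists_le_one N
    exact ⟨Q, hQ, ENNReal.ofReal_le_one.2 h⟩
  · refine ⟨⌈120 / ε ^ 2⌉₊ + 1, fun q hq => ?_⟩
    refine hΘ.one_le hε (by omega) ?_ (by positivity)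
    exact (Nat.le_ceil _).trans (by exact_mod_cast (by omega))
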